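/- Let $d\ge 1$ be a fixed integer. There are an algorithm and a constant $C=C(d)$ such that the following holds for all $0<\varepsilon<\frac12$ and all $n\ge 1$. Given $\varepsilon$ and a sequence $P=(p_1,\dots,p_n)$ of $n$ points in $\mathbb R^d$ (repetitions allowed), the algorithm computes, in at most $C\,(n/\varepsilon^d+n\log n)$ steps, a list, possibly with repetitions, of at most $C\,n/\varepsilon^d$ real numbers whose set $Z$ of entries has this property: for every pairwise Euclidean distance $y\in L(P)=\{\|p_i-p_j\| : 1\le i<j\le n\}$ there are $x,x'\in Z$ with $$x\le y\le x'\le (1+\varepsilon)\,x .$$ Here an algorithm is a single program, depending only on $d$, for a real RAM: a random access machine with indirectly addressed integer and real arrays, in which each of the following counts as one step: reading or writing a cell, using a (natural or rational) constant, addition, subtraction and comparison of natural numbers (subtraction truncated at $0$), the operations $+,-,\times,\div,\sqrt{\phantom{x}}$ and comparison on real numbers, and a Boolean or control operation. There is no rounding operation. -/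

import Mathlib

/-! A real RAM with unit-cost operations.

The memory consists of integer arrays and real arrays, all infinite and addressed indirectly; a
program mentions finitely many of them, by fixed names, and its variables are cells with constant
index. Integers (natural numbers) can be added, subtracted and compared; real numbers can be added,
subtracted, multiplied, divided, compared, and their square roots can be taken. There is no
rounding and no other passage from real numbers to integers. -/

namespace RealRAM

/-- Memory: `s.nat a i` is cell `i` of the integer array named `a`, and `s.real a i` is cell `i` of
the real array named `a`. -/
structure State where
  nat : ℕ → ℕ → ℕ
  real : ℕ → ℕ → ℝ

/-- Integer expressions; subtraction is truncated at zero. -/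
inductive NatExpr where
  | const (k : ℕ)
  | read (a : ℕ) (i : NatExpr)
  | add (e f : NatExpr)
  | sub (e f : NatExpr)

/-- The value of an integer expression. -/
def NatExpr.eval (s : State) : NatExpr → ℕ
  | .const k => k
  | .read a i => s.nat a (i.eval s)
  | .add e f => e.eval s + f.eval s
  | .sub e f => e.eval s - f.eval s

/-- The number of elementary operations that evaluate an integer expression. -/
def NatExpr.cost : NatExpr → ℕ
  | .const _ => 1
  | .read _ i => i.cost + 1
  | .add e f => e.cost + f.cost + 1
  | .sub e f => e.cost + f.cost + 1

/-- Real expressions. Only rational constants may be written in a program. -/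
inductive RealExpr where
  | const (q : ℚ)
  | read (a : ℕ) (i : NatExpr)
  | add (e f : RealExpr)
  | sub (e f : RealExpr)
  | mul (e f : RealExpr)
  | div (e f : RealExpr)
  | sqrt (e : RealExpr)

/-- The value of a real expression; a division by zero and the square root of a negative number
return zero. -/
noncomputable def RealExpr.eval (s : State) : RealExpr → ℝ
  | .const q => (q : ℝ)
  | .read a i => s.real a (i.eval s)
  | .add e f => e.eval s + f.eval s
  | .sub e f => e.eval s - f.eval s
  | .mul e f => e.eval s * f.eval s
  | .div e f => e.eval s / f.eval s
  | .sqrt e => Real.sqrt (e.eval s)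

/-- The number of elementary operations that evaluate a real expression. -/
def RealExpr.cost : RealExpr → ℕ
  | .const _ => 1
  | .read _ i => i.cost + 1
  | .add e f => e.cost + f.cost + 1
  | .sub e f => e.cost + f.cost + 1
  | .mul e f => e.cost + f.cost + 1
  | .div e f => e.cost + f.cost + 1
  | .sqrt e => e.cost + 1

/-- Tests: comparisons of integers and of real numbers, and their Boolean combinations. -/
inductive Test where
  | natLt (e f : NatExpr)
  | realLt (e f : RealExpr)
  | not (b : Test)
  | and (b c : Test)

/-- The test succeeds. -/
def Test.Holds (s : State) : Test → Prop
  | .natLt e f => e.eval s < f.eval s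
  | .realLt e f => e.eval s < f.eval s
  | .not b => ¬ b.Holds s
  | .and b c => b.Holds s ∧ c.Holds s

/-- The number of elementary operations that evaluate a test. -/
def Test.cost : Test → ℕ
  | .natLt e f => e.cost + f.cost + 1
  | .realLt e f => e.cost + f.cost + 1
  | .not b => b.cost + 1
  | .and b c => b.cost + c.cost + 1

/-- Programs: `setNat a i e` and `setReal a i e` store the value of `e` in cell `i` of array `a`. -/
inductive Prog where
  | skip
  | setNat (a : ℕ) (i e : NatExpr)
  | setReal (a : ℕ) (i : NatExpr) (e : RealExpr)
  | seq (p q : Prog)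
  | branch (b : Test) (p q : Prog)
  | loop (b : Test) (p : Prog)

/-- Store `v` in cell `i` of the integer array `a`. -/
def State.writeNat (s : State) (a i v : ℕ) : State :=
  { s with nat := Function.update s.nat a (Function.update (s.nat a) i v) }

/-- Store `v` in cell `i` of the real array `a`. -/
noncomputable def State.writeReal (s : State) (a i : ℕ) (v : ℝ) : State :=
  { s with real := Function.update s.real a (Function.update (s.real a) i v) }

/-- `Runs p s t s'`: started in state `s`, the program `p` halts after exactly `t` elementary
operations, in state `s'`. -/
inductive Runs : Prog → State → ℕ → State → Prop
  | skip (s : State) : Runs .skip s 1 s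
  | setNat (s : State) (a : ℕ) (i e : NatExpr) :
      Runs (.setNat a i e) s (i.cost + e.cost + 1) (s.writeNat a (i.eval s) (e.eval s))
  | setReal (s : State) (a : ℕ) (i : NatExpr) (e : RealExpr) :
      Runs (.setReal a i e) s (i.cost + e.cost + 1) (s.writeReal a (i.eval s) (e.eval s))
  | seq {p q : Prog} {s s' s'' : State} {t t' : ℕ} :
      Runs p s t s' → Runs q s' t' s'' → Runs (.seq p q) s (t + t') s''
  | branchTrue {b : Test} {p q : Prog} {s s' : State} {t : ℕ} :
      b.Holds s → Runs p s t s' → Runs (.branch b p q) s (b.cost + t + 1) s'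
  | branchFalse {b : Test} {p q : Prog} {s s' : State} {t : ℕ} :
      ¬ b.Holds s → Runs q s t s' → Runs (.branch b p q) s (b.cost + t + 1) s'
  | loopTrue {b : Test} {p : Prog} {s s' s'' : State} {t t' : ℕ} :
      b.Holds s → Runs p s t s' → Runs (.loop b p) s' t' s'' →
        Runs (.loop b p) s (b.cost + t + t' + 1) s''
  | loopFalse {b : Test} {p : Prog} {s : State} :
      ¬ b.Holds s → Runs (.loop b p) s (b.cost + 1) s

/-- The machine is deterministic: the running time and the final state are determined by the
program and the initial state. -/
theorem Runs.unique {p : Prog} {s s₁ s₂ : State} {t₁ t₂ : ℕ}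
    (h₁ : Runs p s t₁ s₁) (h₂ : Runs p s t₂ s₂) : t₁ = t₂ ∧ s₁ = s₂ := by
  induction h₁ generalizing t₂ s₂ with
  | skip | setNat | setReal => cases h₂; exact ⟨rfl, rfl⟩
  | seq _ _ ih ih' =>
    cases h₂ with
    | seq k k' =>
      obtain ⟨rfl, rfl⟩ := ih k
      obtain ⟨rfl, rfl⟩ := ih' k'
      exact ⟨rfl, rfl⟩
  | branchTrue hb _ ih =>
    cases h₂ with
    | branchTrue _ k => obtain ⟨rfl, rfl⟩ := ih k; exact ⟨rfl, rfl⟩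
    | branchFalse hb' _ => exact absurd hb hb'
  | branchFalse hb _ ih =>
    cases h₂ with
    | branchTrue hb' _ => exact absurd hb' hb
    | branchFalse _ k => obtain ⟨rfl, rfl⟩ := ih k; exact ⟨rfl, rfl⟩
  | loopTrue hb _ _ ih ih' =>
    cases h₂ with
    | loopTrue _ k k' =>
      obtain ⟨rfl, rfl⟩ := ih k
      obtain ⟨rfl, rfl⟩ := ih' k'
      exact ⟨rfl, rfl⟩
    | loopFalse hb' => exact absurd hb hb'
  | loopFalse hb =>
    cases h₂ with
    | loopTrue hb' _ _ => exact absurd hb' hb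
    | loopFalse _ => exact ⟨rfl, rfl⟩

/-- The initial memory for the points `p 0, …, p (n - 1)` of `ℝ ^ d` and the number `ε`: cell `0` of
integer array `0` holds `n`, cell `i` of real array `j < d` holds the coordinate `j` of `p i`, and
cell `0` of real array `d` holds `ε`. Every other cell holds zero. -/
noncomputable def inputState {d n : ℕ} (ε : ℝ) (p : Fin n → EuclideanSpace ℝ (Fin d)) : State where
  nat a i := if a = 0 ∧ i = 0 then n else 0
  real a i :=
    if h : a < d ∧ i < n then p ⟨i, h.2⟩ ⟨a, h.1⟩
    else if a = d ∧ i = 0 then ε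
    else 0

/-- The list of numbers that a final state presents as the output: cell `0` of integer array `1`
holds its length, and real array `0` holds its entries, in the cells `0, 1, 2, …`. -/
def State.output (s : State) : List ℝ :=
  (List.range (s.nat 1 0)).map (s.real 0)

end RealRAM

/-- The set `L(P)` of pairwise distances of the points `p 0, …, p (n - 1)`. -/
def pairwiseDistances {d n : ℕ} (p : Fin n → EuclideanSpace ℝ (Fin d)) : Set ℝ :=
  {y | ∃ i j : Fin n, i < j ∧ y = dist (p i) (p j)}

/-! The `d * n` coordinates of all points are pooled into one sorted list. Each coordinate
difference of two points is then a sum of consecutive gaps of this list.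

Let D be the sum of any set of gaps, and let k be least such that the k smallest gaps have a sum S ≥
D. Then S ≤ 2D. This is clear for k = 0. For k > 0, the first k - 1 gaps sum to less than D, and the
k-th is at most D: otherwise every gap used in D would be smaller than the k-th, hence be among the
first k - 1, and these would sum to at least D. So the `d * n` sums of initial segments of the
sorted gaps approximate all coordinate differences up to the factor 2 (`exists_sum_range_near`,
`exists_sum_gaps_near`).

A distance lies between the largest coordinate difference and d times that difference
(`exists_abs_sub_le_dist_le`), hence in [S/2, dS] for one of these sums S. The progression (1 +
mε)S/2 with m < ⌈2d/ε⌉ covers this interval, and its consecutive terms have ratio at most 1 + ε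
because it starts at S/2 (`exists_multiples_near`). It is generated by adding ε and comparing, so no
rounding is needed. The output has O(d²n/ε) entries, which suffices because ε^d ≤ ε. The remaining
cost is that of two merge sorts of at most `d * n` numbers (`mergeSort_terminates`). -/

open Finset

namespace RealRAM

/-! ### A logic of total correctness with running times -/

/-- Started in `s`, the program `p` halts within `T` operations in a state satisfying `Q`. -/
def Terminates (p : Prog) (s : State) (T : ℕ) (Q : State → Prop) : Prop :=
  ∃ t s', Runs p s t s' ∧ t ≤ T ∧ Q s'

theorem Terminates.mono {p : Prog} {s : State} {T T' : ℕ} {Q R : State → Prop}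
    (h : Terminates p s T Q) (hT : T ≤ T') (hQ : ∀ s', Q s' → R s') : Terminates p s T' R := by
  obtain ⟨t, s', hr, ht, hs⟩ := h
  exact ⟨t, s', hr, ht.trans hT, hQ _ hs⟩

theorem Terminates.seq {p q : Prog} {s : State} {T₁ T₂ T : ℕ} {Q R : State → Prop}
    (h₁ : Terminates p s T₁ R) (h₂ : ∀ s', R s' → Terminates q s' T₂ Q) (hT : T₁ + T₂ ≤ T) :
    Terminates (.seq p q) s T Q := by
  obtain ⟨t, s', hr, ht, hs⟩ := h₁
  obtain ⟨t', s'', hr', ht', hs'⟩ := h₂ s' hs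
  exact ⟨_, _, .seq hr hr', by omega, hs'⟩

theorem Terminates.setNat {s : State} {a : ℕ} {i e : NatExpr} {T : ℕ} {Q : State → Prop}
    (hT : i.cost + e.cost + 1 ≤ T) (hQ : Q (s.writeNat a (i.eval s) (e.eval s))) :
    Terminates (.setNat a i e) s T Q :=
  ⟨_, _, .setNat .., hT, hQ⟩

/-- A loop halts within `μ s` operations if `μ` pays for every round. -/
theorem Terminates.loop {b : Test} {p : Prog} {Q : State → Prop} (I : State → Prop)
    (μ : State → ℕ)
    (step : ∀ s, I s → b.Holds s →
      ∃ T, Terminates p s T fun s' => I s' ∧ T + μ s' + b.cost + 1 ≤ μ s)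
    (exit : ∀ s, I s → ¬ b.Holds s → b.cost + 1 ≤ μ s ∧ Q s) (s : State) (hs : I s) :
    Terminates (.loop b p) s (μ s) Q := by
  induction h : μ s using Nat.strong_induction_on generalizing s with
  | _ m ih =>
    subst h
    by_cases hb : b.Holds s
    · obtain ⟨T, t, s', hr, ht, hI, hμ⟩ := step s hs hb
      obtain ⟨t', s'', hr', ht', hQ⟩ := ih (μ s') (by omega) s' hI rfl
      exact ⟨_, _, .loopTrue hb hr hr', by omega, hQ⟩
    · obtain ⟨hc, hQ⟩ := exit s hs hb
      exact ⟨_, _, .loopFalse hb, hc, hQ⟩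

/-- A loop whose rounds cost at most `c` halts within `(ν s + 1) * c` operations if `ν` bounds the
number of rounds. -/
theorem Terminates.loop_const {b : Test} {p : Prog} {Q : State → Prop} (I : State → Prop)
    (ν : State → ℕ) (c T : ℕ) (hc : T + b.cost + 1 ≤ c)
    (step : ∀ s, I s → b.Holds s → Terminates p s T fun s' => I s' ∧ ν s' < ν s)
    (exit : ∀ s, I s → ¬ b.Holds s → Q s) (s : State) (hs : I s) :
    Terminates (.loop b p) s ((ν s + 1) * c) Q := by
  refine Terminates.loop I (fun s => (ν s + 1) * c) (fun s hs hb => ⟨T, ?_⟩)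
    (fun s hs hb => ⟨?_, exit s hs hb⟩) s hs
  · refine (step s hs hb).mono le_rfl fun s' ⟨h, hν⟩ => ⟨h, ?_⟩
    have : (ν s' + 1 + 1) * c ≤ (ν s + 1) * c := Nat.mul_le_mul_right _ (by omega)
    rw [Nat.add_mul (ν s' + 1)] at this
    omega
  · have : 1 * c ≤ (ν s + 1) * c := Nat.mul_le_mul_right _ (by omega)
    omega

/-! ### Reading a memory that has been written to -/

theorem State.nat_writeNat (s : State) (a i v b j : ℕ) :
    (s.writeNat a i v).nat b j = if b = a ∧ j = i then v else s.nat b j := by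
  by_cases h : b = a
  · subst h
    simp [State.writeNat, Function.update_apply]
  · simp [State.writeNat, h]

theorem State.real_writeNat (s : State) (a i v : ℕ) : (s.writeNat a i v).real = s.real := rfl

theorem State.nat_writeReal (s : State) (a i : ℕ) (v : ℝ) : (s.writeReal a i v).nat = s.nat := rfl

theorem State.real_writeReal (s : State) (a i : ℕ) (v : ℝ) (b : ℕ) :
    (s.writeReal a i v).real b = if b = a then Function.update (s.real b) i v else s.real b := by
  by_cases h : b = a
  · subst h
    simp [State.writeReal]
  · simp [State.writeReal, h]

/-- The variable kept in cell `0` of integer array `a`. -/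
abbrev var (a : ℕ) : NatExpr := .read a (.const 0)

/-- Assignment to the variable kept in cell `0` of integer array `a`. -/
abbrev assign (a : ℕ) (e : NatExpr) : Prog := .setNat a (.const 0) e

/-- Increment of the variable kept in cell `0` of integer array `a`. -/
abbrev increment (a : ℕ) : Prog := assign a (.add (var a) (.const 1))

/-! ### Merging

The variables of the sorting program are the integer arrays `2` (length), `3` (width of the sorted
runs), `4`, `5`, `6` (bounds of the two runs being merged), `7`, `8` (positions in them) and `9`
(position in the target). It sorts real array `d + 1` with the help of real array `d + 2`. -/

/-- The runs `[lo, mid)` and `[mid, hi)` of `f` have been merged into `g` up to the positions `i`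
and `j`; below `lo`, `g` agrees with `g₀`. -/
structure Merging (f g₀ g : ℕ → ℝ) (lo mid hi i j k : ℕ) : Prop where
  lo_le : lo ≤ i
  le_mid : i ≤ mid
  mid_le : mid ≤ j
  le_hi : j ≤ hi
  target : k + mid = i + j
  sorted : ∀ x y, lo ≤ x → x ≤ y → y < k → g x ≤ g y
  left : ∀ x, lo ≤ x → x < k → i < mid → g x ≤ f i
  right : ∀ x, lo ≤ x → x < k → j < hi → g x ≤ f j
  sum : ∀ φ : ℝ → ℝ, ∑ x ∈ Ico lo k, φ (g x) = ∑ x ∈ Ico lo i, φ (f x) + ∑ x ∈ Ico mid j, φ (f x)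
  below : ∀ x < lo, g x = g₀ x

section Merging

variable {f g₀ g : ℕ → ℝ} {lo mid hi i j k : ℕ}

theorem Merging.start (h₁ : lo ≤ mid) (h₂ : mid ≤ hi) :
    Merging f g₀ g₀ lo mid hi lo mid lo where
  lo_le := le_rfl
  le_mid := h₁
  mid_le := le_rfl
  le_hi := h₂
  target := rfl
  sorted := by intros; omega
  left := by intros; omega
  right := by intros; omega
  sum := by simp
  below := by simp

theorem Merging.sum_update (h : Merging f g₀ g lo mid hi i j k) (v : ℝ) (φ : ℝ → ℝ) :
    ∑ x ∈ Ico lo (k + 1), φ (Function.update g k v x) =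
      ∑ x ∈ Ico lo i, φ (f x) + ∑ x ∈ Ico mid j, φ (f x) + φ v := by
  have := h.lo_le; have := h.target; have := h.mid_le
  rw [sum_Ico_succ_top (by omega), Function.update_self, ← h.sum φ]
  congr 1
  refine sum_congr rfl fun x hx => ?_
  rw [Function.update_of_ne (by simp at hx; omega)]

theorem Merging.step_left (h : Merging f g₀ g lo mid hi i j k)
    (hf : ∀ x y, lo ≤ x → x ≤ y → y < mid → f x ≤ f y) (hi' : i < mid)
    (hle : j < hi → f i ≤ f j) :
    Merging f g₀ (Function.update g k (f i)) lo mid hi (i + 1) j (k + 1) := by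
  obtain ⟨h1, h2, h3, h4, h5, hs, hl, hr, hφ, hb⟩ := id h
  refine ⟨by omega, by omega, by omega, by omega, by omega, ?_, ?_, ?_, ?_, ?_⟩
  · intro x y hx hxy hy
    rcases (Nat.lt_succ_iff.1 hy).eq_or_lt with rfl | hy
    · rcases hxy.eq_or_lt with rfl | hxy
      · exact le_rfl
      · simpa [hxy.ne] using hl x hx hxy hi'
    · rw [Function.update_of_ne (by omega), Function.update_of_ne (by omega)]
      exact hs x y hx hxy hy
  · intro x hx hxk hi''
    refine le_trans ?_ (hf i (i + 1) h1 (by omega) hi'')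
    rcases (Nat.lt_succ_iff.1 hxk).eq_or_lt with rfl | hxk
    · simp
    · simpa [hxk.ne] using hl x hx hxk hi'
  · intro x hx hxk hj
    rcases (Nat.lt_succ_iff.1 hxk).eq_or_lt with rfl | hxk
    · simpa using hle hj
    · simpa [hxk.ne] using hr x hx hxk hj
  · intro φ
    rw [h.sum_update, sum_Ico_succ_top h1]
    ring
  · intro x hx
    rw [Function.update_of_ne (by omega), hb x hx]

theorem Merging.step_right (h : Merging f g₀ g lo mid hi i j k)
    (hf : ∀ x y, mid ≤ x → x ≤ y → y < hi → f x ≤ f y) (hj : j < hi)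
    (hle : i < mid → f j ≤ f i) :
    Merging f g₀ (Function.update g k (f j)) lo mid hi i (j + 1) (k + 1) := by
  obtain ⟨h1, h2, h3, h4, h5, hs, hl, hr, hφ, hb⟩ := id h
  refine ⟨by omega, by omega, by omega, by omega, by omega, ?_, ?_, ?_, ?_, ?_⟩
  · intro x y hx hxy hy
    rcases (Nat.lt_succ_iff.1 hy).eq_or_lt with rfl | hy
    · rcases hxy.eq_or_lt with rfl | hxy
      · exact le_rfl
      · simpa [hxy.ne] using hr x hx hxy hj
    · rw [Function.update_of_ne (by omega), Function.update_of_ne (by omega)]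
      exact hs x y hx hxy hy
  · intro x hx hxk hi'
    rcases (Nat.lt_succ_iff.1 hxk).eq_or_lt with rfl | hxk
    · simpa using hle hi'
    · simpa [hxk.ne] using hl x hx hxk hi'
  · intro x hx hxk hj'
    refine le_trans ?_ (hf j (j + 1) h3 (by omega) hj')
    rcases (Nat.lt_succ_iff.1 hxk).eq_or_lt with rfl | hxk
    · simp
    · simpa [hxk.ne] using hr x hx hxk hj
  · intro φ
    rw [h.sum_update, sum_Ico_succ_top h3]
    ring
  · intro x hx
    rw [Function.update_of_ne (by omega), hb x hx]

end Merging

/-- The length of the array is `N`, and the accuracy `ε` is still in place. -/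
def Frame (d N : ℕ) (ε : ℝ) (s : State) : Prop := s.nat 2 0 = N ∧ s.real d 0 = ε

/-- One step of merging: move the smaller head of the two runs. -/
def mergeStep (d : ℕ) : Prog :=
  .seq
    (.branch
      (.and (.natLt (var 7) (var 5))
        (.not (.and (.natLt (var 8) (var 6))
          (.realLt (.read (d + 1) (var 8)) (.read (d + 1) (var 7))))))
      (.seq (.setReal (d + 2) (var 9) (.read (d + 1) (var 7))) (increment 7))
      (.seq (.setReal (d + 2) (var 9) (.read (d + 1) (var 8))) (increment 8)))
    (increment 9)

/-- Merge two adjacent runs of real array `d + 1` into real array `d + 2`. -/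
def mergeRuns (d : ℕ) : Prog := .loop (.natLt (var 9) (var 6)) (mergeStep d)

theorem mergeRuns_terminates {d N w lo mid hi : ℕ} {ε : ℝ} {f g₀ : ℕ → ℝ}
    (hf₁ : ∀ x y, lo ≤ x → x ≤ y → y < mid → f x ≤ f y)
    (hf₂ : ∀ x y, mid ≤ x → x ≤ y → y < hi → f x ≤ f y) (h₁ : lo ≤ mid) (h₂ : mid ≤ hi)
    (s : State) (hs : Frame d N ε s) (hw : s.nat 3 0 = w) (hA : s.real (d + 1) = f)
    (hB : s.real (d + 2) = g₀) (hmid : s.nat 5 0 = mid) (hhi : s.nat 6 0 = hi)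
    (hi₀ : s.nat 7 0 = lo) (hj₀ : s.nat 8 0 = mid) (hk₀ : s.nat 9 0 = lo) :
    Terminates (mergeRuns d) s ((hi - lo + 1) * 50) fun s' =>
      Frame d N ε s' ∧ s'.nat 3 0 = w ∧ s'.real (d + 1) = f ∧ s'.nat 6 0 = hi ∧
        Merging f g₀ (s'.real (d + 2)) lo mid hi mid hi hi := by
  have key := Terminates.loop_const (b := .natLt (var 9) (var 6)) (p := mergeStep d)
    (fun s => Frame d N ε s ∧ s.nat 3 0 = w ∧ s.real (d + 1) = f ∧ s.nat 5 0 = mid ∧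
      s.nat 6 0 = hi ∧
      Merging f g₀ (s.real (d + 2)) lo mid hi (s.nat 7 0) (s.nat 8 0) (s.nat 9 0))
    (Q := fun s' =>
      Frame d N ε s' ∧ s'.nat 3 0 = w ∧ s'.real (d + 1) = f ∧ s'.nat 6 0 = hi ∧
        Merging f g₀ (s'.real (d + 2)) lo mid hi mid hi hi)
    (fun s => hi - s.nat 9 0) 50 40 (by simp [Test.cost, NatExpr.cost]) ?_ ?_ s
    ⟨hs, hw, hA, hmid, hhi, by rw [hB, hi₀, hj₀, hk₀]; exact .start h₁ h₂⟩
  · rw [hk₀] at key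
    exact key
  · rintro s ⟨⟨hN, hε⟩, hw, hA, hmid, hhi, hm⟩ hb
    simp only [Test.Holds, NatExpr.eval, hhi] at hb
    by_cases ht : (Test.and (.natLt (var 7) (var 5))
        (.not (.and (.natLt (var 8) (var 6))
          (.realLt (.read (d + 1) (var 8)) (.read (d + 1) (var 7)))))).Holds s
    · refine ⟨_, _, .seq (.branchTrue ht (.seq (.setReal ..) (.setNat ..))) (.setNat ..), ?_, ?_⟩
      · simp [Test.cost, NatExpr.cost, RealExpr.cost]
      · simp only [Test.Holds, NatExpr.eval, RealExpr.eval, hmid, hhi, hA] at ht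
        have := hm.step_left hf₁ ht.1 fun hj => not_lt.1 fun hlt => ht.2 ⟨hj, hlt⟩
        simp [Frame, State.nat_writeNat, State.real_writeNat, State.nat_writeReal,
          State.real_writeReal, NatExpr.eval, RealExpr.eval, hN, hε, hw, hA, hmid, hhi, this]
        omega
    · refine ⟨_, _, .seq (.branchFalse ht (.seq (.setReal ..) (.setNat ..))) (.setNat ..), ?_, ?_⟩
      · simp [Test.cost, NatExpr.cost, RealExpr.cost]
      · simp only [Test.Holds, NatExpr.eval, RealExpr.eval, hmid, hhi, hA, not_and] at ht
        -- The target is not full, so an exhausted right run would leave the left run nonempty and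
        -- the test would have succeeded. Hence the right run still has a head.
        have := hm.le_mid; have := hm.le_hi; have := hm.target
        have := hm.step_right hf₂ (by by_contra hj; exact ht (by omega) fun h => absurd h hj)
          fun hi => by by_contra! hlt; exact ht hi fun _ => hlt.not_gt
        simp [Frame, State.nat_writeNat, State.real_writeNat, State.nat_writeReal,
          State.real_writeReal, NatExpr.eval, RealExpr.eval, hN, hε, hw, hA, hmid, hhi, this]
        omega
  · rintro s ⟨hF, hw, hA, hmid, hhi, hm⟩ hb
    simp only [Test.Holds, NatExpr.eval, hhi] at hb
    -- With `k ≥ hi`, the balance `k + mid = i + j` forces both runs to be exhausted exactly.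
    have := hm.le_mid; have := hm.le_hi; have := hm.target
    have e₁ : s.nat 7 0 = mid := by omega
    have e₂ : s.nat 8 0 = hi := by omega
    have e₃ : s.nat 9 0 = hi := by omega
    rw [e₁, e₂, e₃] at hm
    exact ⟨hF, hw, hA, hhi, hm⟩

/-! ### One pass of the merge sort -/

/-- The blocks of length `w` of `f`, cut off at `n`, are sorted. -/
def SortedRuns (f : ℕ → ℝ) (w n : ℕ) : Prop :=
  ∀ q x y, q * w ≤ x → x ≤ y → y < q * w + w → y < n → f x ≤ f y

/-- On `[0, n)`, the functions `f` and `g` take the same values equally often. -/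
def SameValues (n : ℕ) (f g : ℕ → ℝ) : Prop :=
  ∀ φ : ℝ → ℝ, ∑ x ∈ range n, φ (f x) = ∑ x ∈ range n, φ (g x)

theorem Merging.sortedRuns {f g₀ g : ℕ → ℝ} {lo mid hi i j q w : ℕ}
    (h : Merging f g₀ g lo mid hi i j hi) (hlo : lo = q * w) (h₀ : SortedRuns g₀ w lo) :
    SortedRuns g w hi := by
  intro r x y hx hxy hy hyn
  by_cases hyl : y < lo
  · rw [h.below x (by omega), h.below y hyl]
    exact h₀ r x y hx hxy hy hyl
  · refine h.sorted x y ?_ hxy hyn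
    -- A block that reaches `lo = q * w` has index at least `q`, so it lies wholly in the part just
    -- merged.
    have h₁ : q * w < (r + 1) * w := by rw [Nat.add_mul]; omega
    have h₂ : q ≤ r := Nat.lt_succ_iff.1 (Nat.lt_of_mul_lt_mul_right h₁)
    have := Nat.mul_le_mul_right w h₂
    omega

/-- Expressing "is a rearrangement of" through sums of arbitrary test functions makes it additive
over adjacent intervals, so no permutation has to be constructed. -/
theorem Merging.sameValues {f g₀ g : ℕ → ℝ} {lo mid hi : ℕ}
    (h : Merging f g₀ g lo mid hi mid hi hi) (h₀ : SameValues lo f g₀) : SameValues hi f g := by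
  intro φ
  have := h.lo_le; have := h.mid_le
  rw [← sum_range_add_sum_Ico (fun x => φ (f x)) (show lo ≤ hi by omega),
    ← sum_range_add_sum_Ico (fun x => φ (g x)) (show lo ≤ hi by omega), h.sum φ,
    sum_Ico_consecutive _ (by omega) (by omega), h₀ φ]
  congr 1
  exact sum_congr rfl fun x hx => by rw [h.below x (mem_range.1 hx)]

/-- Find the next two runs and merge them. -/
def mergeNext (d : ℕ) : Prog :=
  .seq (assign 5 (.add (var 4) (var 3)))
  (.seq (.branch (.natLt (var 2) (var 5)) (assign 5 (var 2)) .skip)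
  (.seq (assign 6 (.add (var 5) (var 3)))
  (.seq (.branch (.natLt (var 2) (var 6)) (assign 6 (var 2)) .skip)
  (.seq (assign 7 (var 4))
  (.seq (assign 8 (var 5))
  (.seq (assign 9 (var 4))
  (.seq (mergeRuns d)
  (assign 4 (var 6)))))))))

/-- Merge the sorted runs of real array `d + 1` in pairs, into real array `d + 2`. -/
def mergePass (d : ℕ) : Prog :=
  .seq (assign 4 (.const 0)) (.loop (.natLt (var 4) (var 2)) (mergeNext d))

theorem assign_min_terminates {s : State} {a b : ℕ} :
    Terminates (.branch (.natLt (var b) (var a)) (assign a (var b)) .skip) s 10 fun s' =>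
      s' = s.writeNat a 0 (min (s.nat a 0) (s.nat b 0)) := by
  by_cases h : (Test.natLt (var b) (var a)).Holds s
  · refine ⟨_, _, .branchTrue h (.setNat ..), by simp [Test.cost, NatExpr.cost], ?_⟩
    simp only [Test.Holds, NatExpr.eval] at h
    simp [NatExpr.eval, min_eq_right h.le]
  · refine ⟨_, _, .branchFalse h (.skip ..), by simp [Test.cost, NatExpr.cost], ?_⟩
    simp only [Test.Holds, NatExpr.eval, not_lt] at h
    simp [State.writeNat, min_eq_left h]

/-- The time bound is linear in the length of the piece merged, so that the costs of the rounds of a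
pass telescope. -/
theorem mergeNext_terminates {d N w q : ℕ} {ε : ℝ} {f : ℕ → ℝ} (hw₀ : 0 < w)
    (hf : SortedRuns f w N) (s : State) (hs : Frame d N ε s) (hw : s.nat 3 0 = w)
    (hA : s.real (d + 1) = f) (hlo : s.nat 4 0 = q * (2 * w)) (hN : s.nat 4 0 < N)
    (hsort : SortedRuns (s.real (d + 2)) (2 * w) (s.nat 4 0))
    (hval : SameValues (s.nat 4 0) f (s.real (d + 2))) :
    Terminates (mergeNext d) s ((min (s.nat 4 0 + 2 * w) N - s.nat 4 0) * 50 + 110) fun s' =>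
      Frame d N ε s' ∧ s'.nat 3 0 = w ∧ s'.real (d + 1) = f ∧
        s'.nat 4 0 = min (s.nat 4 0 + 2 * w) N ∧ SortedRuns (s'.real (d + 2)) (2 * w) (s'.nat 4 0) ∧
        SameValues (s'.nat 4 0) f (s'.real (d + 2)) := by
  obtain ⟨hlen, hε⟩ := hs
  generalize hl : s.nat 4 0 = lo at *
  refine .seq (T₁ := 7)
    (T₂ := 10 + (7 + (10 + (4 + (4 + (4 + ((min (lo + 2 * w) N - lo + 1) * 50 + 4)))))))
    (.setNat (by simp [NatExpr.cost]) rfl) ?_ (by omega)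
  rintro _ rfl
  refine .seq assign_min_terminates ?_ le_rfl
  rintro _ rfl
  refine .seq (T₁ := 7) (.setNat (by simp [NatExpr.cost]) rfl) ?_ le_rfl
  rintro _ rfl
  refine .seq assign_min_terminates ?_ le_rfl
  rintro _ rfl
  refine .seq (T₁ := 4) (.setNat (by simp [NatExpr.cost]) rfl) ?_ le_rfl
  rintro _ rfl
  refine .seq (T₁ := 4) (.setNat (by simp [NatExpr.cost]) rfl) ?_ le_rfl
  rintro _ rfl
  refine .seq (T₁ := 4) (.setNat (by simp [NatExpr.cost]) rfl) ?_ le_rfl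
  rintro _ rfl
  have hhi : min (min (lo + w) N + w) N = min (lo + 2 * w) N := by omega
  refine .seq (mergeRuns_terminates (N := N) (ε := ε) (w := w) (lo := lo) (mid := min (lo + w) N)
    (hi := min (lo + 2 * w) N) (f := f) (g₀ := s.real (d + 2)) ?_ ?_ (by omega) (by omega) _
    ?_ ?_ ?_ ?_ ?_ ?_ ?_ ?_ ?_) ?_ le_rfl
  · intro x y hx hxy hy
    -- The two runs are the blocks `2 * q` and `2 * q + 1` of width `w`; if the array ends early,
    -- the second one is empty.
    have : 2 * q * w = lo := by rw [hlo]; ring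
    exact hf (2 * q) x y (by omega) hxy (by omega) (by omega)
  · intro x y hx hxy hy
    have : (2 * q + 1) * w = lo + w := by rw [hlo]; ring
    exact hf (2 * q + 1) x y (by omega) hxy (by omega) (by omega)
  rotate_right
  · rintro s' ⟨⟨hlen', hε'⟩, hw', hA', hhi', hm⟩
    refine .setNat (by simp [NatExpr.cost]) ?_
    simp only [Frame, State.nat_writeNat, State.real_writeNat, NatExpr.eval, hlen', hε', hw', hA',
      hhi']
    simpa using ⟨hm.sortedRuns hlo hsort, hm.sameValues hval⟩
  all_goals
    simp [Frame, State.nat_writeNat, State.real_writeNat, NatExpr.eval, hlen, hε, hw, hA, hl, hhi]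

theorem mergePass_terminates {d N w : ℕ} {ε : ℝ} {f : ℕ → ℝ} (hw₀ : 0 < w)
    (hf : SortedRuns f w N) (s : State) (hs : Frame d N ε s) (hw : s.nat 3 0 = w)
    (hA : s.real (d + 1) = f) :
    Terminates (mergePass d) s (N * 170 + 10) fun s' =>
      Frame d N ε s' ∧ s'.nat 3 0 = w ∧ SortedRuns (s'.real (d + 2)) (2 * w) N ∧
        SameValues N f (s'.real (d + 2)) := by
  obtain ⟨hlen, hε⟩ := hs
  refine .seq (T₁ := 3) (T₂ := N * 170 + 6) (.setNat (by simp [NatExpr.cost]) rfl) ?_ (by omega)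
  rintro _ rfl
  -- A round that advances by Δ ≥ 1 costs at most 50Δ + 110, plus 6 for the test and the loop, which
  -- is at most 170Δ. The final 6 pays for the failing test.
  refine (Terminates.loop (fun s => Frame d N ε s ∧ s.nat 3 0 = w ∧ s.real (d + 1) = f ∧
      s.nat 4 0 ≤ N ∧ (s.nat 4 0 = N ∨ ∃ q, s.nat 4 0 = q * (2 * w)) ∧
      SortedRuns (s.real (d + 2)) (2 * w) (s.nat 4 0) ∧
      SameValues (s.nat 4 0) f (s.real (d + 2)))
    (fun s => (N - s.nat 4 0) * 170 + 6) ?_ ?_ _ ?_).mono ?_ fun _ h => h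
  · rintro s ⟨hF, hw, hA, hle, hq, hsort, hval⟩ hb
    simp only [Test.Holds, NatExpr.eval, hF.1] at hb
    obtain ⟨q, hq⟩ := hq.resolve_left hb.ne
    refine ⟨_, (mergeNext_terminates hw₀ hf s hF hw hA hq hb hsort hval).mono le_rfl ?_⟩
    rintro s' ⟨hF', hw', hA', hlo', hsort', hval'⟩
    refine ⟨⟨hF', hw', hA', by omega, ?_, hsort', hval'⟩, ?_⟩
    · by_cases h : s.nat 4 0 + 2 * w ≤ N
      · exact .inr ⟨q + 1, by rw [hlo', min_eq_left h, hq]; ring⟩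
      · exact .inl (by omega)
    · simp only [Test.cost, NatExpr.cost]
      omega
  · rintro s ⟨hF, hw, hA, hle, hq, hsort, hval⟩ hb
    simp only [Test.Holds, NatExpr.eval, hF.1] at hb
    obtain rfl : s.nat 4 0 = N := by omega
    exact ⟨by simp [Test.cost, NatExpr.cost], hF, hw, hsort, hval⟩
  · simp [Frame, State.nat_writeNat, State.real_writeNat, NatExpr.eval, hlen, hε, hw, hA,
      SortedRuns, SameValues]
  · simp [State.nat_writeNat, NatExpr.eval]

/-! ### The merge sort -/

/-- Copy real array `d + 2` back to real array `d + 1`. -/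
def copyBack (d : ℕ) : Prog :=
  .seq (assign 9 (.const 0))
    (.loop (.natLt (var 9) (var 2))
      (.seq (.setReal (d + 1) (var 9) (.read (d + 2) (var 9))) (increment 9)))

theorem copyBack_terminates {d N w : ℕ} {ε : ℝ} {g : ℕ → ℝ} (s : State) (hs : Frame d N ε s)
    (hw : s.nat 3 0 = w) (hB : s.real (d + 2) = g) :
    Terminates (copyBack d) s (N * 20 + 30) fun s' =>
      Frame d N ε s' ∧ s'.nat 3 0 = w ∧ ∀ x < N, s'.real (d + 1) x = g x := by
  obtain ⟨hlen, hε⟩ := hs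
  refine .seq (T₁ := 3) (T₂ := (N + 1) * 20) (.setNat (by simp [NatExpr.cost]) rfl) ?_ (by omega)
  rintro _ rfl
  refine (Terminates.loop_const (fun s => Frame d N ε s ∧ s.nat 3 0 = w ∧ s.real (d + 2) = g ∧
      ∀ x < s.nat 9 0, s.real (d + 1) x = g x)
    (fun s => N - s.nat 9 0) 20 14 (by simp [Test.cost, NatExpr.cost]) ?_ ?_ _ ?_).mono ?_
    fun _ h => h
  · rintro s ⟨⟨hlen, hε⟩, hw, hB, hx⟩ hb
    simp only [Test.Holds, NatExpr.eval, hlen] at hb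
    refine ⟨_, _, .seq (.setReal ..) (.setNat ..), ?_, ?_⟩
    · simp [NatExpr.cost, RealExpr.cost]
    · simp [Frame, State.nat_writeNat, State.real_writeNat, State.nat_writeReal,
        State.real_writeReal, NatExpr.eval, RealExpr.eval, hlen, hε, hw, hB,
        Function.update_apply]
      refine ⟨fun x hx' => ?_, by omega⟩
      split_ifs with h
      · rw [h]
      · exact hx x (by omega)
  · rintro s ⟨hF, hw, hB, hx⟩ hb
    simp only [Test.Holds, NatExpr.eval, hF.1] at hb
    exact ⟨hF, hw, fun x hxN => hx x (by omega)⟩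
  · simp [Frame, State.nat_writeNat, State.real_writeNat, NatExpr.eval, hlen, hε, hw, hB]
  · simp [State.nat_writeNat, NatExpr.eval]

/-- Sort real array `d + 1` by bottom-up merging. -/
def mergeSort (d : ℕ) : Prog :=
  .seq (assign 3 (.const 1))
    (.loop (.natLt (var 3) (var 2))
      (.seq (mergePass d) (.seq (copyBack d) (assign 3 (.add (var 3) (var 3))))))

theorem mergeSort_terminates {d N : ℕ} {ε : ℝ} {f : ℕ → ℝ} (s : State) (hs : Frame d N ε s)
    (hA : s.real (d + 1) = f) :
    Terminates (mergeSort d) s ((Nat.clog 2 N + 1) * (N * 190 + 60) + 3) fun s' =>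
      Frame d N ε s' ∧ (∀ x y, x ≤ y → y < N → s'.real (d + 1) x ≤ s'.real (d + 1) y) ∧
        SameValues N f (s'.real (d + 1)) := by
  obtain ⟨hlen, hε⟩ := hs
  refine .seq (T₁ := 3) (T₂ := (Nat.clog 2 N + 1) * (N * 190 + 60))
    (.setNat (by simp [NatExpr.cost]) rfl) ?_ (by omega)
  rintro _ rfl
  -- The width is a power of two that doubles in each round, so its logarithm counts the rounds.
  refine (Terminates.loop_const (fun s => Frame d N ε s ∧ s.nat 3 0 = 2 ^ Nat.log 2 (s.nat 3 0) ∧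
      SortedRuns (s.real (d + 1)) (s.nat 3 0) N ∧ SameValues N f (s.real (d + 1)))
    (fun s => Nat.clog 2 N - Nat.log 2 (s.nat 3 0)) (N * 190 + 60)
    (N * 170 + 10 + (N * 20 + 30 + 7))
    (by simp only [Test.cost, NatExpr.cost]; omega) ?_ ?_ _ ?_).mono ?_ fun _ h => h
  · rintro s ⟨hF, hw, hsort, hval⟩ hb
    simp only [Test.Holds, NatExpr.eval, hF.1] at hb
    generalize hr : Nat.log 2 (s.nat 3 0) = r at *
    refine .seq (mergePass_terminates (by rw [hw]; positivity) hsort s hF rfl rfl) ?_ le_rfl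
    rintro s₁ ⟨hF₁, hw₁, hsort₁, hval₁⟩
    refine .seq (copyBack_terminates s₁ hF₁ hw₁ rfl) ?_ le_rfl
    rintro s₂ ⟨⟨hlen₂, hε₂⟩, hw₂, hcopy⟩
    refine .setNat (by simp [NatExpr.cost]) ?_
    have hw' : s.nat 3 0 + s.nat 3 0 = 2 ^ (r + 1) := by rw [hw]; ring
    have hlog : Nat.log 2 (2 ^ (r + 1)) = r + 1 := Nat.log_pow (by norm_num) _
    have hlt : r < Nat.clog 2 N := (Nat.lt_clog_iff_pow_lt (by norm_num)).2 (hw ▸ hb)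
    simp [Frame, State.nat_writeNat, State.real_writeNat, NatExpr.eval, hlen₂, hε₂, hw₂, hw', hlog]
    refine ⟨⟨?_, ?_⟩, by omega⟩
    · rw [← hw', ← two_mul]
      intro q x y hx hxy hy hyN
      rw [hcopy x (by omega), hcopy y hyN]
      exact hsort₁ q x y hx hxy hy hyN
    · intro φ
      rw [hval φ, hval₁ φ]
      exact sum_congr rfl fun x hx => by rw [hcopy x (mem_range.1 hx)]
  · rintro s ⟨hF, hw, hsort, hval⟩ hb
    simp only [Test.Holds, NatExpr.eval, hF.1] at hb
    -- Once the width is at least `N`, block `0` is the whole array.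
    exact ⟨hF, fun x y hxy hy => hsort 0 x y (by omega) hxy (by omega) hy, hval⟩
  · simp [Frame, State.nat_writeNat, State.real_writeNat, NatExpr.eval, hlen, hε, hA, SameValues]
    intro q x y hx hxy hy hyN
    rw [show x = y by omega]
  · simp [State.nat_writeNat, NatExpr.eval]

/-! ### The numbers from which the output is built -/

/-- Append the first `j` coordinates of all points to real array `d + 1`. -/
def loadCoordinates (d : ℕ) : ℕ → Prog
  | 0 => assign 2 (.const 0)
  | j + 1 =>
    .seq (loadCoordinates d j)
      (.seq (assign 9 (.const 0))
        (.loop (.natLt (var 9) (var 0))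
          (.seq (.setReal (d + 1) (var 2) (.read j (var 9)))
            (.seq (increment 2) (increment 9)))))

/-- Only the presence of each coordinate in the list is recorded: its position will be lost in the
sorting anyway. -/
theorem loadCoordinates_terminates {d n : ℕ} {ε : ℝ} (X : ℕ → ℕ → ℝ) (s : State)
    (hn : s.nat 0 0 = n) (hε : s.real d 0 = ε) (hX : ∀ i < d, s.real i = X i) (j : ℕ)
    (hj : j ≤ d) :
    Terminates (loadCoordinates d j) s (j * (n * 30 + 40) + 3) fun s' =>
      s'.nat 0 0 = n ∧ Frame d (j * n) ε s' ∧ (∀ i < d, s'.real i = X i) ∧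
        ∀ i < j, ∀ k < n, ∃ x < j * n, s'.real (d + 1) x = X i k := by
  induction j with
  | zero =>
    refine .setNat (by simp [NatExpr.cost]) ?_
    simp [Frame, State.nat_writeNat, State.real_writeNat, NatExpr.eval, hn, hε]
    exact hX
  | succ j ih =>
    refine .seq (T₂ := 3 + (n + 1) * 30) (ih (by omega)) ?_ (by rw [Nat.add_mul j]; omega)
    rintro s₁ ⟨hn₁, ⟨hlen₁, hε₁⟩, hX₁, hx₁⟩
    refine .seq (T₁ := 3) (.setNat (by simp [NatExpr.cost]) rfl) ?_ le_rfl
    rintro _ rfl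
    refine (Terminates.loop_const (fun s => s.nat 0 0 = n ∧ s.real d 0 = ε ∧
        (∀ i < d, s.real i = X i) ∧ s.nat 9 0 ≤ n ∧ s.nat 2 0 = j * n + s.nat 9 0 ∧
        (∀ i < j, ∀ k < n, ∃ x < j * n, s.real (d + 1) x = X i k) ∧
        ∀ k < s.nat 9 0, s.real (d + 1) (j * n + k) = X j k)
      (fun s => n - s.nat 9 0) 30 24 (by simp [Test.cost, NatExpr.cost]) ?_ ?_ _ ?_).mono ?_
      fun _ h => h
    · rintro s ⟨hn, hε, hX, hle, hlen, hx, hxj⟩ hb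
      simp only [Test.Holds, NatExpr.eval, hn] at hb
      refine ⟨_, _, .seq (.setReal ..) (.seq (.setNat ..) (.setNat ..)), ?_, ?_⟩
      · simp [NatExpr.cost, RealExpr.cost]
      · simp [State.nat_writeNat, State.real_writeNat, State.nat_writeReal,
          State.real_writeReal, NatExpr.eval, RealExpr.eval, hn, hε, Function.update_apply, hlen,
          hX j (by omega)]
        refine ⟨⟨fun i hi => ?_, by omega, by omega, fun i hi k hk => ?_, fun k hk => ?_⟩, by omega⟩
        · rw [if_neg (by omega), hX i hi]
        · obtain ⟨x, hxlt, hxe⟩ := hx i hi k hk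
          exact ⟨x, hxlt, by rw [if_neg (by omega), hxe]⟩
        · split_ifs with h
          · rw [h]
          · exact hxj k (by omega)
    · rintro s ⟨hn, hε, hX, hle, hlen, hx, hxj⟩ hb
      simp only [Test.Holds, NatExpr.eval, hn] at hb
      have h9 : s.nat 9 0 = n := by omega
      have hmul : (j + 1) * n = j * n + n := by ring
      refine ⟨hn, ⟨by rw [hlen, h9, hmul], hε⟩, hX, fun i hi k hk => ?_⟩
      rcases (Nat.lt_succ_iff.1 hi).eq_or_lt with rfl | hi
      · exact ⟨i * n + k, by omega, hxj k (by omega)⟩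
      · obtain ⟨x, hxlt, hxe⟩ := hx i hi k hk
        exact ⟨x, by omega, hxe⟩
    · simp [State.nat_writeNat, State.real_writeNat, NatExpr.eval, hn₁, hε₁, hlen₁]
      exact ⟨hX₁, hx₁⟩
    · simp [State.nat_writeNat, NatExpr.eval]

/-- Replace the entries of real array `d + 1` by the differences of consecutive entries. -/
def takeGaps (d : ℕ) : Prog :=
  .seq (assign 2 (.sub (var 2) (.const 1)))
  (.seq (assign 9 (.const 0))
    (.loop (.natLt (var 9) (var 2))
      (.seq (.setReal (d + 1) (var 9)
        (.sub (.read (d + 1) (.add (var 9) (.const 1))) (.read (d + 1) (var 9))))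
      (increment 9))))

theorem takeGaps_terminates {d N : ℕ} {ε : ℝ} {f : ℕ → ℝ} (s : State) (hs : Frame d N ε s)
    (hA : s.real (d + 1) = f) :
    Terminates (takeGaps d) s (N * 30 + 40) fun s' =>
      Frame d (N - 1) ε s' ∧ ∀ x < N - 1, s'.real (d + 1) x = f (x + 1) - f x := by
  obtain ⟨hlen, hε⟩ := hs
  refine .seq (T₁ := 6) (T₂ := 3 + (N - 1 + 1) * 30) (.setNat (by simp [NatExpr.cost]) rfl) ?_
    (by omega)
  rintro _ rfl
  refine .seq (T₁ := 3) (.setNat (by simp [NatExpr.cost]) rfl) ?_ le_rfl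
  rintro _ rfl
  -- The replacement in place is sound because a gap needs only entries that have not yet been
  -- overwritten.
  refine (Terminates.loop_const (fun s => Frame d (N - 1) ε s ∧
      (∀ x < s.nat 9 0, s.real (d + 1) x = f (x + 1) - f x) ∧
      ∀ x ≥ s.nat 9 0, s.real (d + 1) x = f x)
    (fun s => N - 1 - s.nat 9 0) 30 24 (by simp [Test.cost, NatExpr.cost]) ?_ ?_ _ ?_).mono ?_
    fun _ h => h
  · rintro s ⟨⟨hlen, hε⟩, hx, hx'⟩ hb
    simp only [Test.Holds, NatExpr.eval, hlen] at hb
    refine ⟨_, _, .seq (.setReal ..) (.setNat ..), ?_, ?_⟩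
    · simp [NatExpr.cost, RealExpr.cost]
    · simp [Frame, State.nat_writeNat, State.real_writeNat, State.nat_writeReal,
        State.real_writeReal, NatExpr.eval, RealExpr.eval, hlen, hε, Function.update_apply]
      refine ⟨⟨fun x hxk => ?_, fun x hxk => ?_⟩, by omega⟩
      · split_ifs with h
        · rw [h, hx' _ (by omega), hx' _ le_rfl]
        · exact hx x (by omega)
      · rw [if_neg (by omega), hx' x (by omega)]
  · rintro s ⟨hF, hx, hx'⟩ hb
    simp only [Test.Holds, NatExpr.eval, hF.1] at hb
    exact ⟨hF, fun x hxN => hx x (by omega)⟩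
  · simp [Frame, State.nat_writeNat, State.real_writeNat, NatExpr.eval, hlen, hε, hA]
  · simp [State.nat_writeNat, NatExpr.eval]

/-! ### The output -/

/-- Append the numbers `(1 + m ε) S / 2` below `(2 d + 1) S / 2` to the output, where `S` is kept
in real array `d + 3`; the factor is kept in real array `d + 4`. -/
def writeMultiples (d : ℕ) : Prog :=
  .seq (.setReal (d + 4) (.const 0) (.const 1))
    (.loop (.realLt (.read (d + 4) (.const 0)) (.const (2 * d + 1)))
      (.seq (.setReal 0 (var 1)
        (.div (.mul (.read (d + 4) (.const 0)) (.read (d + 3) (.const 0))) (.const 2)))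
      (.seq (increment 1)
        (.setReal (d + 4) (.const 0) (.add (.read (d + 4) (.const 0)) (.read d (.const 0)))))))

theorem writeMultiples_terminates {d M k l : ℕ} {ε S : ℝ} {g out : ℕ → ℝ} (hd : 1 ≤ d)
    (hε₀ : 0 < ε) (s : State) (hs : Frame d M ε s) (hk : s.nat 9 0 = k) (hl : s.nat 1 0 = l)
    (hA : s.real (d + 1) = g) (hS : s.real (d + 3) 0 = S) (hout : s.real 0 = out) :
    Terminates (writeMultiples d) s (⌈2 * d / ε⌉₊ * 40 + 50) fun s' =>
      Frame d M ε s' ∧ s'.nat 9 0 = k ∧ s'.nat 1 0 = l + ⌈2 * d / ε⌉₊ ∧ s'.real (d + 1) = g ∧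
        s'.real (d + 3) 0 = S ∧ (∀ x < l, s'.real 0 x = out x) ∧
        ∀ m < ⌈2 * d / ε⌉₊, s'.real 0 (l + m) = (1 + m * ε) * S / 2 := by
  -- The output overwrites real array `0`, which must differ from array `d`, where ε is kept.
  have hd₀ : d ≠ 0 := by omega
  obtain ⟨hlen, hε⟩ := hs
  set K := ⌈2 * d / ε⌉₊ with hK
  -- The real comparison that stops the loop thus counts to the ceiling, without any rounding.
  have hlt : ∀ m : ℕ, 1 + m * ε < 2 * d + 1 ↔ m < K := by
    intro m
    rw [hK, Nat.lt_ceil, lt_div_iff₀ hε₀]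
    constructor <;> intro h <;> linarith
  refine .seq (T₁ := 3) (T₂ := (K + 1) * 40)
    ⟨_, _, .setReal .., by simp [NatExpr.cost, RealExpr.cost], rfl⟩ ?_ (by omega)
  rintro _ rfl
  refine (Terminates.loop_const (fun s => Frame d M ε s ∧ s.nat 9 0 = k ∧ s.real (d + 1) = g ∧
      s.real (d + 3) 0 = S ∧ l ≤ s.nat 1 0 ∧ s.nat 1 0 ≤ l + K ∧
      s.real (d + 4) 0 = 1 + (s.nat 1 0 - l : ℕ) * ε ∧ (∀ x < l, s.real 0 x = out x) ∧
      ∀ m < s.nat 1 0 - l, s.real 0 (l + m) = (1 + m * ε) * S / 2)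
    (fun s => l + K - s.nat 1 0) 40 30 (by simp [Test.cost, NatExpr.cost, RealExpr.cost])
    ?_ ?_ _ ?_).mono ?_ fun _ h => h
  · rintro s ⟨⟨hlen, hε⟩, hk, hA, hS, hl, hlK, hr, hx, hm⟩ hb
    simp only [Test.Holds, RealExpr.eval, NatExpr.eval, hr] at hb
    push_cast at hb
    rw [hlt] at hb
    refine ⟨_, _, .seq (.setReal ..) (.seq (.setNat ..) (.setReal ..)), ?_, ?_⟩
    · simp [NatExpr.cost, RealExpr.cost]
    · have e : s.nat 1 0 + 1 - l = s.nat 1 0 - l + 1 := by omega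
      simp [Frame, State.nat_writeNat, State.real_writeNat, State.nat_writeReal,
        State.real_writeReal, NatExpr.eval, RealExpr.eval, hlen, hε, hk, hA, hS, hd₀, hr,
        Function.update_apply, e]
      refine ⟨⟨by omega, by omega, by ring, fun x hxl => ?_, fun m hml => ?_⟩, by omega⟩
      · rw [if_neg (by omega), hx x hxl]
      · split_ifs with h
        · rw [show m = s.nat 1 0 - l by omega]
        · exact hm m (by omega)
  · rintro s ⟨hF, hk, hA, hS, hl, hlK, hr, hx, hm⟩ hb
    simp only [Test.Holds, RealExpr.eval, NatExpr.eval, hr] at hb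
    push_cast at hb
    rw [hlt] at hb
    exact ⟨hF, hk, by omega, hA, hS, hx, fun m hmK => hm m (by omega)⟩
  · simp [Frame, State.nat_writeReal, State.real_writeReal, NatExpr.eval, RealExpr.eval, hlen, hε,
      hk, hl, hA, hS, hout]
  · simp [State.nat_writeReal, hl]

/-- Append multiples of all sums of initial segments of real array `d + 1` to the output. -/
def writeOutput (d : ℕ) : Prog :=
  .seq (assign 1 (.const 0))
  (.seq (.setReal (d + 3) (.const 0) (.const 0))
  (.seq (assign 9 (.const 0))
    (.loop (.natLt (var 9) (.add (var 2) (.const 1)))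
      (.seq (writeMultiples d)
      (.seq (.setReal (d + 3) (.const 0) (.add (.read (d + 3) (.const 0)) (.read (d + 1) (var 9))))
      (increment 9))))))

theorem writeOutput_terminates {d M : ℕ} {ε : ℝ} {g : ℕ → ℝ} (hd : 1 ≤ d) (hε₀ : 0 < ε)
    (s : State) (hs : Frame d M ε s) (hA : s.real (d + 1) = g) :
    Terminates (writeOutput d) s ((M + 2) * (⌈2 * d / ε⌉₊ * 40 + 80) + 9) fun s' =>
      s'.nat 1 0 = (M + 1) * ⌈2 * d / ε⌉₊ ∧
        ∀ k ≤ M, ∀ m < ⌈2 * d / ε⌉₊, ∃ x < s'.nat 1 0,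
          s'.real 0 x = (1 + m * ε) * (∑ i ∈ range k, g i) / 2 := by
  obtain ⟨hlen, hε⟩ := hs
  set K := ⌈2 * d / ε⌉₊ with hK
  refine .seq (T₁ := 3) (T₂ := 3 + (3 + (M + 1 + 1) * (K * 40 + 80)))
    (.setNat (by simp [NatExpr.cost]) rfl) ?_ (by rw [add_assoc M]; omega)
  rintro _ rfl
  refine .seq (T₁ := 3) ⟨_, _, .setReal .., by simp [NatExpr.cost, RealExpr.cost], rfl⟩ ?_ le_rfl
  rintro _ rfl
  refine .seq (T₁ := 3) (.setNat (by simp [NatExpr.cost]) rfl) ?_ le_rfl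
  rintro _ rfl
  -- There are `M + 1` initial segments, including the empty one, which serves coincident points.
  -- The last round also adds the cell after the list, but that sum is never output.
  refine (Terminates.loop_const (fun s => Frame d M ε s ∧ s.real (d + 1) = g ∧ s.nat 9 0 ≤ M + 1 ∧
      s.real (d + 3) 0 = ∑ i ∈ range (s.nat 9 0), g i ∧ s.nat 1 0 = s.nat 9 0 * K ∧
      ∀ k < s.nat 9 0, ∀ m < K, ∃ x < s.nat 1 0,
        s.real 0 x = (1 + m * ε) * (∑ i ∈ range k, g i) / 2)
    (fun s => M + 1 - s.nat 9 0) (K * 40 + 80) (K * 40 + 50 + (8 + 6))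
    (by simp [Test.cost, NatExpr.cost]) ?_ ?_ _ ?_).mono ?_ fun _ h => h
  · rintro s ⟨hF, hA, hle, hS, hl, hx⟩ hb
    simp only [Test.Holds, NatExpr.eval, hF.1] at hb
    refine .seq (writeMultiples_terminates hd hε₀ s hF rfl hl hA hS rfl) ?_ le_rfl
    rintro s₁ ⟨⟨hlen₁, hε₁⟩, hk₁, hl₁, hA₁, hS₁, hx₁, hm₁⟩
    refine ⟨_, _, .seq (.setReal ..) (.setNat ..), ?_, ?_⟩
    · simp [NatExpr.cost, RealExpr.cost]
    · simp [Frame, State.nat_writeNat, State.real_writeNat, State.nat_writeReal,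
        State.real_writeReal, NatExpr.eval, RealExpr.eval, hlen₁, hε₁, hk₁, hA₁, hS₁, hl₁,
        sum_range_succ]
      refine ⟨⟨by omega, by rw [← hK]; ring, fun k hk m hm => ?_⟩, by omega⟩
      rcases hk.eq_or_lt with rfl | hk
      · exact ⟨_, by omega, hm₁ m hm⟩
      · obtain ⟨x, hxl, hxe⟩ := hx k hk m hm
        exact ⟨x, by omega, by rw [hx₁ x (by omega), hxe]⟩
  · rintro s ⟨hF, hA, hle, hS, hl, hx⟩ hb
    simp only [Test.Holds, NatExpr.eval, hF.1] at hb
    have h9 : s.nat 9 0 = M + 1 := by omega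
    exact ⟨by rw [hl, h9], fun k hk => hx k (by omega)⟩
  · simp [Frame, State.nat_writeNat, State.real_writeNat, State.nat_writeReal,
      State.real_writeReal, NatExpr.eval, RealExpr.eval, hlen, hε, hA]
  · simp [State.nat_writeNat, NatExpr.eval]

/-! ### The algorithm -/

/-- Sort the coordinates of all points together, sort the gaps between them, and write multiples of
the sums of the smallest gaps. -/
def approximateDistances (d : ℕ) : Prog :=
  .seq (loadCoordinates d d)
    (.seq (mergeSort d) (.seq (takeGaps d) (.seq (mergeSort d) (writeOutput d))))

/-! ### Coordinate differences and sums of smallest gaps -/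

theorem SameValues.exists_eq {n : ℕ} {f g : ℕ → ℝ} (h : SameValues n f g) {x : ℕ} (hx : x < n) :
    ∃ y < n, g y = f x := by
  by_contra! hne
  -- The indicator of the value `f x` counts its occurrences on both sides.
  have := h fun v => if v = f x then 1 else 0
  rw [sum_eq_zero (s := range n) (f := fun y => if g y = f x then (1 : ℝ) else 0)
    fun y hy => if_neg (hne y (mem_range.1 hy))] at this
  have hpos : (0 : ℝ) < ∑ y ∈ range n, if f y = f x then (1 : ℝ) else 0 :=
    sum_pos' (fun _ _ => by split_ifs <;> norm_num) ⟨x, mem_range.2 hx, by simp⟩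
  linarith

/-- If nonnegative numbers are sorted, the sum of some of them is approximated up to the factor `2`
by the sum of an initial segment. -/
theorem exists_sum_range_near {M : ℕ} {f g : ℕ → ℝ} (hf : ∀ x < M, 0 ≤ f x)
    (hg : ∀ x y, x ≤ y → y < M → g x ≤ g y) (hfg : SameValues M f g) {T : Finset ℕ}
    (hT : T ⊆ range M) :
    ∃ k ≤ M, ∑ x ∈ T, f x ≤ ∑ x ∈ range k, g x ∧
      ∑ x ∈ range k, g x ≤ 2 * ∑ x ∈ T, f x := by
  have hf' : ∀ x ∈ range M, 0 ≤ f x := fun x hx => hf x (mem_range.1 hx)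
  have hg' : ∀ x < M, 0 ≤ g x := by
    intro x hx
    obtain ⟨y, hy, e⟩ := SameValues.exists_eq (fun φ => (hfg φ).symm) hx
    exact e ▸ hf y hy
  have hy₀ : 0 ≤ ∑ x ∈ T, f x := sum_nonneg fun x hx => hf' x (hT hx)
  have hex : ∃ k, ∑ x ∈ T, f x ≤ ∑ x ∈ range k, g x :=
    ⟨M, (sum_le_sum_of_subset_of_nonneg hT fun x hx _ => hf' x hx).trans_eq (hfg id)⟩
  classical
  refine ⟨Nat.find hex, Nat.find_min' hex
    ((sum_le_sum_of_subset_of_nonneg hT fun x hx _ => hf' x hx).trans_eq (hfg id)),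
    Nat.find_spec hex, ?_⟩
  have hkM : Nat.find hex ≤ M := Nat.find_min' hex
    ((sum_le_sum_of_subset_of_nonneg hT fun x hx _ => hf' x hx).trans_eq (hfg id))
  rcases hk : Nat.find hex with _ | k
  · simpa using hy₀
  · have hlt : ∑ x ∈ range k, g x < ∑ x ∈ T, f x := not_le.1 (Nat.find_min hex (by omega))
    rw [hk] at hkM
    -- Otherwise all terms of `T` lie strictly below `g k`. Truncating at this value transfers their
    -- sum from `f` to `g`, where only the first `k` entries contribute.
    have hgk : g k ≤ ∑ x ∈ T, f x := by
      by_contra! hgk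
      refine hlt.not_ge ?_
      calc ∑ x ∈ T, f x = ∑ x ∈ T, if f x < g k then f x else 0 := by
            refine sum_congr rfl fun x hx => (if_pos (lt_of_le_of_lt ?_ hgk)).symm
            exact single_le_sum (f := f) (fun i hi => hf' i (hT hi)) hx
        _ ≤ ∑ x ∈ range M, if f x < g k then f x else 0 := by
            refine sum_le_sum_of_subset_of_nonneg hT fun x hx _ => ?_
            split_ifs
            exacts [hf' x hx, le_rfl]
        _ = ∑ x ∈ range M, if g x < g k then g x else 0 := hfg fun v => if v < g k then v else 0
        _ = ∑ x ∈ range k, if g x < g k then g x else 0 := by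
            refine (sum_subset (range_mono (by omega)) fun x hx hxk => if_neg ?_).symm
            exact (hg k x (by simpa using hxk) (mem_range.1 hx)).not_gt
        _ ≤ ∑ x ∈ range k, g x := by
            refine sum_le_sum fun x hx => ?_
            split_ifs
            exacts [le_rfl, hg' x (by simp at hx; omega)]
    rw [sum_range_succ]
    linarith

/-- The difference of two numbers is approximated up to the factor `2` by the sum of the smallest
gaps in a set containing them. -/
theorem exists_sum_gaps_near {N : ℕ} {f g : ℕ → ℝ} (hf : ∀ x y, x ≤ y → y < N → f x ≤ f y)
    (hg : ∀ x y, x ≤ y → y < N - 1 → g x ≤ g y)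
    (hfg : SameValues (N - 1) (fun x => f (x + 1) - f x) g) {x y : ℕ} (hx : x < N) (hy : y < N) :
    ∃ k ≤ N - 1, |f x - f y| ≤ ∑ i ∈ range k, g i ∧ ∑ i ∈ range k, g i ≤ 2 * |f x - f y| := by
  wlog hxy : x ≤ y generalizing x y
  · simpa only [abs_sub_comm] using this hy hx (by omega)
  have e : |f x - f y| = ∑ i ∈ Ico x y, (f (i + 1) - f i) := by
    rw [sum_Ico_sub f hxy, abs_sub_comm, abs_of_nonneg (sub_nonneg.2 (hf x y hxy hy))]
  rw [e]
  refine exists_sum_range_near (fun i hi => sub_nonneg.2 (hf i (i + 1) (by omega) (by omega))) hg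
    hfg fun i hi => ?_
  simp at hi ⊢
  omega

theorem approximateDistances_terminates {d n : ℕ} {ε : ℝ} (hd : 1 ≤ d) (hε₀ : 0 < ε)
    (p : Fin n → EuclideanSpace ℝ (Fin d)) :
    Terminates (approximateDistances d) (inputState ε p)
      (d * (n * 30 + 40) + 3 + 2 * ((Nat.clog 2 (d * n) + 1) * (d * n * 190 + 60) + 3) +
        (d * n * 30 + 40) + ((d * n + 2) * (⌈2 * d / ε⌉₊ * 40 + 80) + 9))
      fun s => s.nat 1 0 = (d * n - 1 + 1) * ⌈2 * d / ε⌉₊ ∧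
        ∀ (i j : Fin n) (c : Fin d), ∃ S : ℝ, |p i c - p j c| ≤ S ∧ S ≤ 2 * |p i c - p j c| ∧
          ∀ m < ⌈2 * d / ε⌉₊, ∃ x < s.nat 1 0, s.real 0 x = (1 + m * ε) * S / 2 := by
  have hclog : Nat.clog 2 (d * n - 1) ≤ Nat.clog 2 (d * n) := Nat.clog_mono_right 2 (by omega)
  have hsort : (Nat.clog 2 (d * n - 1) + 1) * ((d * n - 1) * 190 + 60) + 3 ≤
      (Nat.clog 2 (d * n) + 1) * (d * n * 190 + 60) + 3 := by
    gcongr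
    omega
  have hwrite : (d * n - 1 + 2) * (⌈2 * d / ε⌉₊ * 40 + 80) + 9 ≤
      (d * n + 2) * (⌈2 * d / ε⌉₊ * 40 + 80) + 9 := by
    gcongr
    omega
  refine .seq (T₂ := (Nat.clog 2 (d * n) + 1) * (d * n * 190 + 60) + 3 + (d * n * 30 + 40 +
      ((Nat.clog 2 (d * n) + 1) * (d * n * 190 + 60) + 3 +
        ((d * n + 2) * (⌈2 * d / ε⌉₊ * 40 + 80) + 9))))
    (loadCoordinates_terminates (n := n) (ε := ε) (inputState ε p).real _ (by simp [inputState])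
      (by simp [inputState]) (fun _ _ => rfl) d le_rfl) ?_ (by omega)
  rintro s₁ ⟨-, hF₁, -, hx₁⟩
  refine .seq (mergeSort_terminates s₁ hF₁ rfl) ?_ le_rfl
  rintro s₂ ⟨hF₂, hsort₂, hval₂⟩
  refine .seq (takeGaps_terminates s₂ hF₂ rfl) ?_ le_rfl
  rintro s₃ ⟨hF₃, hgap⟩
  refine .seq (mergeSort_terminates s₃ hF₃ rfl) ?_ (Nat.add_le_add hsort hwrite)
  rintro s₄ ⟨hF₄, hsort₄, hval₄⟩
  refine (writeOutput_terminates hd hε₀ s₄ hF₄ rfl).mono le_rfl ?_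
  rintro s₅ ⟨hl, hx₅⟩
  refine ⟨hl, fun i j c => ?_⟩
  have hval : SameValues (d * n - 1)
      (fun x => s₂.real (d + 1) (x + 1) - s₂.real (d + 1) x) (s₄.real (d + 1)) := by
    intro φ
    rw [← hval₄ φ]
    exact sum_congr rfl fun x hx => by rw [hgap x (mem_range.1 hx)]
  have hcoord : ∀ i : Fin n, ∃ x < d * n, s₂.real (d + 1) x = p i c := by
    intro i
    obtain ⟨x, hx, e⟩ := hx₁ c c.2 i i.2
    obtain ⟨y, hy, e'⟩ := hval₂.exists_eq hx
    exact ⟨y, hy, by rw [e', e]; simp [inputState]⟩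
  obtain ⟨x, hx, ex⟩ := hcoord i
  obtain ⟨y, hy, ey⟩ := hcoord j
  obtain ⟨k, hk, h₁, h₂⟩ := exists_sum_gaps_near hsort₂ hsort₄ hval hx hy
  rw [ex, ey] at h₁ h₂
  exact ⟨_, h₁, h₂, hx₅ k hk⟩

/-! ### From coordinate differences to distances -/

theorem exists_abs_sub_le_dist_le {d : ℕ} (hd : 1 ≤ d) (u v : EuclideanSpace ℝ (Fin d)) :
    ∃ c, |u c - v c| ≤ dist u v ∧ dist u v ≤ d * |u c - v c| := by
  have : Nonempty (Fin d) := ⟨⟨0, hd⟩⟩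
  -- The coordinate of largest difference works; the sharp factor √d is relaxed to `d`.
  obtain ⟨c, hc⟩ := Finite.exists_max fun c => |u c - v c|
  have hd' : (1 : ℝ) ≤ d := by exact_mod_cast hd
  refine ⟨c, ?_, ?_⟩ <;> rw [EuclideanSpace.dist_eq]
  · refine Real.le_sqrt_of_sq_le ?_
    rw [← Real.dist_eq]
    exact single_le_sum (f := fun i => dist (u i) (v i) ^ 2) (fun _ _ => sq_nonneg _) (mem_univ c)
  · refine Real.sqrt_le_iff.2 ⟨by positivity, ?_⟩
    calc ∑ i, dist (u i) (v i) ^ 2 ≤ ∑ _i : Fin d, |u c - v c| ^ 2 :=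
          sum_le_sum fun i _ => pow_le_pow_left₀ dist_nonneg (hc i) 2
      _ = d * |u c - v c| ^ 2 := by simp
      _ ≤ d ^ 2 * |u c - v c| ^ 2 := by
          gcongr
          nlinarith
      _ = _ := by ring

/-- Multiples of `S / 2` approximate every number between `S / 2` and `d S`. -/
theorem exists_multiples_near {d : ℕ} {ε S y : ℝ} (hε₀ : 0 < ε) (hε₁ : ε < 1) (hd : 1 ≤ d)
    (h₁ : S / 2 ≤ y) (h₂ : y ≤ d * S) :
    ∃ m < ⌈2 * d / ε⌉₊, ∃ m' < ⌈2 * d / ε⌉₊, (1 + m * ε) * S / 2 ≤ y ∧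
      y ≤ (1 + m' * ε) * S / 2 ∧ (1 + m' * ε) * S / 2 ≤ (1 + ε) * ((1 + m * ε) * S / 2) := by
  have hd' : (1 : ℝ) ≤ d := by exact_mod_cast hd
  -- For negative `S` one would have `d * S ≤ S < S / 2`, leaving no room for `y`.
  have hS : 0 ≤ S := by
    by_contra! hS
    nlinarith
  rcases hS.eq_or_lt with rfl | hS
  · have : 0 < ⌈2 * d / ε⌉₊ := Nat.ceil_pos.2 (by positivity)
    exact ⟨0, this, 0, this, by simp_all, by simp_all, by simp⟩
  have hu : 0 ≤ (2 * y / S - 1) / ε := div_nonneg (by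
    rw [sub_nonneg, one_le_div hS]
    linarith) hε₀.le
  have hm₁ := Nat.floor_le hu
  have hm₂ := Nat.lt_floor_add_one ((2 * y / S - 1) / ε)
  set m := ⌊(2 * y / S - 1) / ε⌋₊
  rw [le_div_iff₀ hε₀, le_sub_iff_add_le, le_div_iff₀ hS] at hm₁
  rw [div_lt_iff₀ hε₀, sub_lt_iff_lt_add, div_lt_iff₀ hS] at hm₂
  have hm : (m : ℝ) * ε + 1 ≤ 2 * d := by
    by_contra! h
    nlinarith
  have hmε : 0 ≤ (m : ℝ) * ε := by positivity
  -- The multiples on either side of `y` are used. From mε + 1 ≤ 2d and ε < 1 follows (m + 1)ε < 2d,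
  -- so `m + 1` is still in range.
  refine ⟨m, ?_, m + 1, ?_, by linarith, ?_, ?_⟩
  · rw [Nat.lt_ceil, lt_div_iff₀ hε₀]
    linarith
  · rw [Nat.lt_ceil, lt_div_iff₀ hε₀]
    push_cast
    linarith
  · push_cast
    linarith
  · push_cast
    -- The product (1 + ε)(1 + mε) exceeds 1 + (m + 1)ε by mε².
    have : 0 ≤ (m : ℝ) * ε * ε * S := by positivity
    nlinarith

/-! ### Estimates for the running time and the output length -/

theorem mul_ceil_le {d n : ℕ} {ε : ℝ} (hd : 1 ≤ d) (hε₀ : 0 < ε) (hε₁ : ε < 1) :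
    (n : ℝ) ≤ n / ε ^ d ∧ (n * ⌈2 * d / ε⌉₊ : ℝ) ≤ 3 * d * (n / ε ^ d) := by
  have hd' : (1 : ℝ) ≤ d := by exact_mod_cast hd
  have hpow : ε ^ d ≤ ε := pow_le_of_le_one hε₀.le hε₁.le (by omega)
  refine ⟨le_div_self n.cast_nonneg (by positivity) (hpow.trans hε₁.le), ?_⟩
  have hceil : (⌈2 * d / ε⌉₊ : ℝ) ≤ 3 * d / ε ^ d := by
    have h₁ : (1 : ℝ) ≤ d / ε := by
      rw [one_le_div hε₀]
      linarith
    calc (⌈2 * d / ε⌉₊ : ℝ) ≤ 2 * d / ε + 1 := (Nat.ceil_lt_add_one (by positivity)).le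
      _ ≤ 2 * d / ε + d / ε := by gcongr
      _ = 3 * d / ε := by ring
      _ ≤ 3 * d / ε ^ d := by gcongr
  calc (n * ⌈2 * d / ε⌉₊ : ℝ) ≤ n * (3 * d / ε ^ d) := by gcongr
    _ = _ := by ring

theorem clog_mul_le {d n : ℕ} (hd : 1 ≤ d) (hn : 1 ≤ n) :
    (Nat.clog 2 (d * n) + 1 : ℝ) ≤ 2 * d + 2 * Real.log n := by
  have hd' : (1 : ℝ) ≤ d := by exact_mod_cast hd
  have hn' : (1 : ℝ) ≤ n := by exact_mod_cast hn
  have hl : 0 ≤ Real.log n := Real.log_nonneg hn'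
  rcases hc : Nat.clog 2 (d * n) with _ | c
  · push_cast
    linarith
  have hlt : 2 ^ c < d * n := (Nat.lt_clog_iff_pow_lt (by norm_num)).1 (by omega)
  have hlog : c * Real.log 2 ≤ Real.log d + Real.log n := by
    rw [← Real.log_pow, ← Real.log_mul (by positivity) (by positivity)]
    exact Real.log_le_log (by positivity) (by exact_mod_cast hlt.le)
  have h₂ : (1 / 2 : ℝ) ≤ Real.log 2 := by linarith [Real.log_two_gt_d9]
  have h₃ := Real.log_le_sub_one_of_pos (show (0 : ℝ) < d by linarith)
  push_cast
  -- Since log 2 ≥ 1/2 and log d ≤ d - 1, this gives c ≤ 2(d - 1) + 2 log n, and the left-hand side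
  -- is c + 2.
  nlinarith [mul_le_mul_of_nonneg_left h₂ c.cast_nonneg]

/-- The bound on the running time, in real numbers. -/
theorem time_le {d n : ℕ} {ε : ℝ} (hd : 1 ≤ d) (hn : 1 ≤ n) (hε₀ : 0 < ε) (hε₁ : ε < 1) :
    ((d * (n * 30 + 40) + 3 + 2 * ((Nat.clog 2 (d * n) + 1) * (d * n * 190 + 60) + 3) +
        (d * n * 30 + 40) + ((d * n + 2) * (⌈2 * d / ε⌉₊ * 40 + 80) + 9) : ℕ) : ℝ) ≤
      2500 * d ^ 2 * (n / ε ^ d + n * Real.log n) := by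
  obtain ⟨h₁, h₂⟩ := mul_ceil_le hd hε₀ hε₁ (n := n)
  have hc := clog_mul_le hd hn
  have hd' : (1 : ℝ) ≤ d := by exact_mod_cast hd
  have hn' : (1 : ℝ) ≤ n := by exact_mod_cast hn
  have hK : (1 : ℝ) ≤ ⌈2 * d / ε⌉₊ := by
    exact_mod_cast Nat.one_le_iff_ne_zero.2 (Nat.ceil_pos.2 (by positivity)).ne'
  push_cast
  generalize (⌈2 * d / ε⌉₊ : ℝ) = K at *
  generalize (Nat.clog 2 (d * n) : ℝ) = c at *
  generalize (n : ℝ) / ε ^ d = E at *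
  have hl : 0 ≤ Real.log n := Real.log_nonneg hn'
  generalize Real.log n = l at *
  generalize (d : ℝ) = D at *
  generalize (n : ℝ) = m at *
  have hDm : 1 ≤ D * m := one_le_mul_of_one_le_of_one_le hd' hn'
  have hDD : D * m ≤ D ^ 2 * m := by nlinarith
  have hml : 0 ≤ m * l := by positivity
  have hDl : D * (m * l) ≤ D ^ 2 * (m * l) := by nlinarith
  have hDE : D ^ 2 * m ≤ D ^ 2 * E := by gcongr
  have hsort : (c + 1) * (D * m * 190 + 60) ≤ (2 * D + 2 * l) * (250 * (D * m)) := by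
    gcongr
    linarith
  have hwrite : (D * m + 2) * (K * 40 + 80) ≤ 3 * (D * m) * (120 * K) := by
    gcongr <;> linarith
  have hDmK : D * (m * K) ≤ D * (3 * D * E) := by gcongr
  -- The two sorts contribute at most 1000D²E + 1000D²ml, the output 1080D²E and the linear terms
  -- 158D²E.
  nlinarith

/-- The bound on the length of the output, in real numbers. -/
theorem length_le {d n : ℕ} {ε : ℝ} (hd : 1 ≤ d) (hn : 1 ≤ n) (hε₀ : 0 < ε) (hε₁ : ε < 1) :
    (((d * n - 1 + 1) * ⌈2 * d / ε⌉₊ : ℕ) : ℝ) ≤ 3 * d ^ 2 * (n / ε ^ d) := by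
  rw [Nat.sub_add_cancel (Nat.mul_pos hd hn)]
  push_cast
  have := (mul_ceil_le hd hε₀ hε₁ (n := n)).2
  calc (d : ℝ) * n * ⌈2 * d / ε⌉₊ = d * (n * ⌈2 * d / ε⌉₊) := by ring
    _ ≤ d * (3 * d * (n / ε ^ d)) := by gcongr
    _ = _ := by ring

end RealRAM

theorem mainTheorem6 (d : ℕ) (hd : 1 ≤ d) :
    ∃ (prog : RealRAM.Prog) (C : ℝ),
      ∀ (ε : ℝ), 0 < ε → ε < 1 / 2 →
      ∀ (n : ℕ), 1 ≤ n →
      ∀ (p : Fin n → EuclideanSpace ℝ (Fin d)),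
      ∃ (t : ℕ) (s : RealRAM.State),
        RealRAM.Runs prog (RealRAM.inputState ε p) t s ∧
        (t : ℝ) ≤ C * ((n : ℝ) / ε ^ d + (n : ℝ) * Real.log (n : ℝ)) ∧
        (s.output.length : ℝ) ≤ C * ((n : ℝ) / ε ^ d) ∧
        ∀ y ∈ pairwiseDistances p, ∃ x ∈ s.output, ∃ x' ∈ s.output,
          x ≤ y ∧ y ≤ x' ∧ x' ≤ (1 + ε) * x := by
  refine ⟨RealRAM.approximateDistances d, 2500 * d ^ 2, fun ε hε₀ hε₁ n hn p => ?_⟩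
  obtain ⟨t, s, hrun, ht, hl, hs⟩ := RealRAM.approximateDistances_terminates hd hε₀ p
  refine ⟨t, s, hrun, ?_, ?_, ?_⟩
  · exact le_trans (by exact_mod_cast ht) (RealRAM.time_le hd hn hε₀ (by linarith))
  · simp only [RealRAM.State.output, List.length_map, List.length_range, hl]
    refine (RealRAM.length_le hd hn hε₀ (by linarith)).trans ?_
    gcongr
    norm_num
  · rintro y ⟨i, j, -, rfl⟩
    obtain ⟨c, hc₁, hc₂⟩ := RealRAM.exists_abs_sub_le_dist_le hd (p i) (p j)
    obtain ⟨S, hS₁, hS₂, hS⟩ := hs i j c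
    -- Here S/2 ≤ |p i c - p j c| ≤ dist ≤ d|p i c - p j c| ≤ dS.
    obtain ⟨m, hm, m', hm', h⟩ := RealRAM.exists_multiples_near (S := S) (y := dist (p i) (p j))
      hε₀ (by linarith) hd (by linarith) (hc₂.trans (by gcongr))
    obtain ⟨x, hx, ex⟩ := hS m hm
    obtain ⟨x', hx', ex'⟩ := hS m' hm'
    rw [← ex, ← ex'] at h
    exact ⟨_, List.mem_map.2 ⟨x, List.mem_range.2 hx, rfl⟩, _,
      List.mem_map.2 ⟨x', List.mem_range.2 hx', rfl⟩, h⟩
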